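/- Let $\mathsf k$ be a field, let $q\ge s\ge 3$ be integers, and write $[q]=\{1,\dots,q\}$. A free resolution of an ideal $I$ of a polynomial ring $R$ is an exact sequence $0\to R^{\beta_t}\to\cdots\to R^{\beta_1}\to R^{\beta_0}\to I\to 0$ with finite ranks; it is minimal if, for each $j$, $\beta_j$ is the smallest rank that occurs in spot $j$ of a free resolution of $I$. A simplicial complex $\Delta$ on the vertices $\mathbf e_1,\dots,\mathbf e_q$ supports a (minimal) free resolution of a monomial ideal $I=(m_1,\dots,m_q)$ if the following sequence is a (minimal) free resolution of $I$: the free module in spot $j$ has as basis the faces of $\Delta$ with $j+1$ vertices, the differential is $$F\longmapsto\sum_{\mathbf e_i\in F}(-1)^{|\{\mathbf e_l\in F\,:\,l<i\}|}\,\frac{\mathrm{lcm}(F)}{\mathrm{lcm}(F\smallsetminus\{\mathbf e_i\})}\;F\smallsetminus\{\mathbf e_i\},\qquad \mathrm{lcm}(F)=\mathrm{lcm}(m_i:\mathbf e_i\in F),$$ and $\{\mathbf e_i\}\mapsto m_i$ is the augmentation to $I$. Let $\Gamma$ be the simplicial complex consisting of all faces of the simplex on $\mathbf e_1,\dots,\mathbf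 e_q$ that do not contain $\{\mathbf e_2,\dots,\mathbf e_s\}$. **Theorem 5.1.** (1) Let $I$ be an ideal of a polynomial ring over $\mathsf k$ in finitely many variables, minimally generated by square-free monomials $m_1,\dots,m_q$ such that $m_1\mid\mathrm{lcm}(m_2,\dots,m_s)$. Then $\Gamma$ supports a free resolution of $I$. (2) Let $J\subseteq\{s+1,\dots,q\}$ (possibly empty) and $$\mathcal D=\{(1,\{2,\dots,s\})\}\cup\{(b,\{2,\dots,s\}):b\in J\}.$$ Let $Q(\mathcal D)$ be the set of all nonempty $A\subseteq[q]$ such that $b\notin A$ or $A\cap B\neq\emptyset$ for every $(b,B)\in\mathcal D$; in $\mathsf k[y_A:\emptyset\ne A\subseteq[q]]$ put $\epsilon_{\mathcal D,i}=\prod_{A\in Q(\mathcal D),\,i\in A}y_A$ for $i\in[q]$, and let $\mathcal E_{q,\mathcal D}=(\epsilon_{\mathcal D,1},\dots,\epsilon_{\mathcal D,q})$ be the $\mathcal D$-extremal ideal. Then the free resolution of $\mathcal E_{q,\mathcal D}$ supported on $\Gamma$, with $\mathbf e_i$ labelled by $\epsilon_{\mathcal D,i}$, is a minimal free resolution. 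-/

import Mathlib

noncomputable section

/-! ### Free resolutions -/

/-- The data of a sequence of free modules
`⋯ → R^(ι 2) → R^(ι 1) → R^(ι 0) → M`
(no exactness is required here); `ι j` is the basis of the free module in spot `j`. -/
structure FreeSequence (R : Type*) [CommRing R] (M : Type*) [AddCommGroup M] [Module R M] where
  /-- the index set of the basis in spot `j` -/
  ι : ℕ → Type
  /-- the differentials -/
  d : ∀ j : ℕ, (ι (j + 1) →₀ R) →ₗ[R] (ι j →₀ R)
  /-- the augmentation -/
  aug : (ι 0 →₀ R) →ₗ[R] M

namespace FreeSequence

variable {R : Type*} [CommRing R] {M : Type*} [AddCommGroup M] [Module R M]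

/-- `0 → R^(β_t) → ⋯ → R^(β_1) → R^(β_0) → M → 0` is exact, all ranks being finite and only
finitely many of them being nonzero. -/
structure IsFreeResolution (C : FreeSequence R M) : Prop where
  finite_rank : ∀ j, Finite (C.ι j)
  finite_length : ∃ t : ℕ, ∀ j, t < j → IsEmpty (C.ι j)
  aug_surjective : Function.Surjective C.aug
  exact_zero : Function.Exact (C.d 0) C.aug
  exact_succ : ∀ j, Function.Exact (C.d (j + 1)) (C.d j)

/-- The free resolution `C` of `M` is minimal: for each `j`, the rank of its free module in
spot `j` is the smallest possible among all free resolutions of `M`. -/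
structure IsMinimalFreeResolution (C : FreeSequence R M) : Prop where
  isFreeResolution : C.IsFreeResolution
  rank_le : ∀ C' : FreeSequence R M, C'.IsFreeResolution →
    ∀ j, Nat.card (C.ι j) ≤ Nat.card (C'.ι j)

end FreeSequence

/-! ### Monomials, written through their exponent vectors -/

/-- The monomial with exponent vector `a` in the polynomial ring `k[x_t : t ∈ τ]`. -/
def mono (k : Type*) [Field k] {τ : Type*} (a : τ →₀ ℕ) : MvPolynomial τ k :=
  MvPolynomial.monomial a 1

/-- The (exponent vector of the) least common multiple of the monomials `m v`, `v ∈ F`. -/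
def lcmLabel {V τ : Type*} (m : V → τ →₀ ℕ) (F : Finset V) : τ →₀ ℕ :=
  F.sup m

/-- The ideal generated by the monomials `m v`, `v ∈ V`. -/
def monomialIdeal (k : Type*) [Field k] {V τ : Type*} (m : V → τ →₀ ℕ) :
    Ideal (MvPolynomial τ k) :=
  Ideal.span (Set.range fun v => mono k (m v))

/-- The family of monomials `m` is a minimal generating family of the ideal it generates:
no proper subfamily generates the same ideal. -/
def MinimallyGenerates (k : Type*) [Field k] {V τ : Type*} (m : V → τ →₀ ℕ) : Prop :=
  ∀ S : Set V, Ideal.span ((fun v => mono k (m v)) '' S) = monomialIdeal k m → S = Set.univ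

/-! ### The homogenized chain complex of a simplicial complex with monomial vertex labels -/

section Homogenization

/-- The faces of dimension `j`, that is, with `j + 1` vertices. -/
def FaceOfDim {V : Type} (Δ : PreAbstractSimplicialComplex V) (j : ℕ) : Type :=
  {F : Finset V // F ∈ Δ.faces ∧ F.card = j + 1}

/-- The facet `F ∖ {v}` of a face `F` of dimension `j + 1`. -/
def FaceOfDim.erase {V : Type} [LinearOrder V] {Δ : PreAbstractSimplicialComplex V} {j : ℕ}
    (F : FaceOfDim Δ (j + 1)) (v : V) (hv : v ∈ F.1) : FaceOfDim Δ j :=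
  ⟨F.1.erase v, by
    have hc : (F.1.erase v).card = j + 1 := by
      rw [Finset.card_erase_of_mem hv, F.2.2]; rfl
    exact ⟨(Δ.isRelLowerSet_faces F.2.1).2 (Finset.erase_subset v F.1)
      (Finset.card_pos.mp (by omega)), hc⟩⟩

theorem mono_lcmLabel_mem (k : Type*) [Field k] {V : Type} {τ : Type*}
    (m : V → τ →₀ ℕ) {Δ : PreAbstractSimplicialComplex V} (F : FaceOfDim Δ 0) :
    mono k (lcmLabel m F.1) ∈ monomialIdeal k m := by
  obtain ⟨v, hv⟩ := Finset.card_eq_one.mp F.2.2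
  refine Ideal.subset_span ⟨v, ?_⟩
  simp [hv, lcmLabel]

variable {V : Type} [LinearOrder V] (Δ : PreAbstractSimplicialComplex V)
variable (k : Type*) [Field k] {τ : Type*} (m : V → τ →₀ ℕ)

/-- The homogenized boundary map
`[F] ↦ ∑ v ∈ F, ± (lcm F / lcm (F ∖ v)) [F ∖ v]`,
where the sign is `+` or `-` according to the parity of the number of vertices of `F`
before `v`. -/
def homogenizedBoundary (j : ℕ) :
    (FaceOfDim Δ (j + 1) →₀ MvPolynomial τ k) →ₗ[MvPolynomial τ k]
      (FaceOfDim Δ j →₀ MvPolynomial τ k) :=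
  Finsupp.linearCombination (MvPolynomial τ k) fun F : FaceOfDim Δ (j + 1) =>
    ∑ v ∈ F.1.attach,
      Finsupp.single (F.erase v.1 v.2)
        ((-1) ^ (F.1.filter fun w => w < v.1).card *
          mono k (lcmLabel m F.1 - lcmLabel m (F.1.erase v.1)))

/-- The homogenization of the (augmented) chain complex of `Δ` by the monomial labels `m`.
A vertex `[{v}]` is sent by the augmentation to the monomial `m v`. -/
abbrev homogenizedChainComplex : FreeSequence (MvPolynomial τ k) (monomialIdeal k m) where
  ι := FaceOfDim Δ
  d := homogenizedBoundary Δ k m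
  aug := Finsupp.linearCombination (MvPolynomial τ k) fun F : FaceOfDim Δ 0 =>
    (⟨mono k (lcmLabel m F.1), mono_lcmLabel_mem k m F⟩ : monomialIdeal k m)

/-- `Δ`, with vertices labelled by `m`, supports a free resolution of the ideal generated
by the labels. -/
def SupportsFreeResolution : Prop :=
  (homogenizedChainComplex Δ k m).IsFreeResolution

/-- `Δ`, with vertices labelled by `m`, supports a minimal free resolution of the ideal
generated by the labels. -/
def SupportsMinimalFreeResolution : Prop :=
  (homogenizedChainComplex Δ k m).IsMinimalFreeResolution

end Homogenization

/-- The subcomplex of the simplex on the vertex set `V` that consists of all the faces that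
do not contain `σ`. -/
def facesNotContaining {V : Type} (σ : Finset V) : PreAbstractSimplicialComplex V where
  faces := {F | F.Nonempty ∧ ¬ σ ⊆ F}
  isRelLowerSet_faces := fun _ hF =>
    ⟨hF.1, fun _ hGF hG => ⟨hG, fun h => hF.2 (h.trans hGF)⟩⟩

/-! ### `𝒟`-extremal ideals

The set `[q] = {1, …, q}` is modelled by `Fin q`: the element `i : Fin q` stands for `i + 1`. -/

/-- The variables `y_A` are indexed by the nonempty subsets `A` of `[q]`. -/
abbrev ExtremalVar (q : ℕ) : Type :=
  {A : Finset (Fin q) // A.Nonempty}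

/-- The set `Q(𝒟)` of all nonempty `A ⊆ [q]` such that, for all `(b, B) ∈ 𝒟`,
`b ∉ A` or `A ∩ B ≠ ∅`. -/
def extremalQ {q : ℕ} (D : Set (Fin q × Finset (Fin q))) : Set (ExtremalVar q) :=
  {A | ∀ p ∈ D, p.1 ∉ A.1 ∨ (A.1 ∩ p.2).Nonempty}

open Classical in
/-- The (exponent vector of the) monomial `ε_{𝒟,i} = ∏ y_A`, the product being over all
`A ∈ Q(𝒟)` with `i ∈ A`. -/
def extremalGen {q : ℕ} (D : Set (Fin q × Finset (Fin q))) (i : Fin q) : ExtremalVar q →₀ ℕ :=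
  ∑ A : ExtremalVar q with A ∈ extremalQ D ∧ i ∈ A.1, Finsupp.single A 1

/-- The subset `{2, …, s}` of `[q]`, that is, the indices `1, …, s - 1` of `Fin q`. -/
def twoToS (q s : ℕ) : Finset (Fin q) :=
  Finset.univ.filter fun i => 1 ≤ i.val ∧ i.val < s

end

noncomputable section

/-! ### The Taylor complex and a multigraded contracting homotopy -/

section Taylor

variable {V : Type} (k : Type*) [Field k] {τ : Type*} (m : V → τ →₀ ℕ)

theorem lcmLabel_mono {F G : Finset V} (h : F ⊆ G) : lcmLabel m F ≤ lcmLabel m G :=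
  Finset.sup_mono h

theorem le_lcmLabel {v : V} {F : Finset V} (h : v ∈ F) : m v ≤ lcmLabel m F :=
  Finset.le_sup h

theorem mono_mul (a b : τ →₀ ℕ) : mono k a * mono k b = mono k (a + b) := by
  simp [mono, MvPolynomial.monomial_mul]

/-- The basis element of multidegree `u` (if `lcm F` divides `u`) belonging to the face `F`. -/
def homogeneousFace (u : τ →₀ ℕ) (F : Finset V) : Finset V →₀ MvPolynomial τ k :=
  Finsupp.single F (mono k (u - lcmLabel m F))

theorem single_monomial_eq_smul_homogeneousFace (F : Finset V) (w : τ →₀ ℕ) (c : k) :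
    Finsupp.single F (MvPolynomial.monomial w c) =
      c • homogeneousFace k m (w + lcmLabel m F) F := by
  rw [homogeneousFace, add_tsub_cancel_right, mono, Finsupp.smul_single,
    MvPolynomial.smul_monomial, smul_eq_mul, mul_one]

variable [LinearOrder V]

/-- The sign of the vertex `v` in the boundary of the face `F`. -/
def boundarySign (v : V) (F : Finset V) : ℤ := (-1) ^ (F.filter fun w => w < v).card

theorem boundarySign_mul_self (v : V) (F : Finset V) :
    boundarySign v F * boundarySign v F = 1 := by
  rw [boundarySign, ← pow_add, ← two_mul, pow_mul]; simp

theorem boundarySign_erase_of_lt {v w : V} {F : Finset V} (hw : w ∈ F) (h : w < v) :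
    boundarySign v (F.erase w) = -boundarySign v F := by
  have hmem : w ∈ F.filter fun x => x < v := by simp [hw, h]
  have hc := Finset.card_erase_add_one hmem
  rw [boundarySign, boundarySign, Finset.filter_erase, ← hc, pow_succ]
  ring

theorem boundarySign_erase_of_not_lt {v w : V} {F : Finset V} (h : ¬ w < v) :
    boundarySign v (F.erase w) = boundarySign v F := by
  rw [boundarySign, boundarySign, Finset.filter_erase, Finset.erase_eq_of_notMem]
  simp [h]

theorem boundarySign_mul_erase {v w : V} {F : Finset V} (hv : v ∈ F) (hw : w ∈ F) (h : v ≠ w) :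
    boundarySign v F * boundarySign w (F.erase v) =
      -(boundarySign w F * boundarySign v (F.erase w)) := by
  rcases lt_or_gt_of_ne h with h | h
  · rw [boundarySign_erase_of_lt hv h, boundarySign_erase_of_not_lt h.not_gt]; ring
  · rw [boundarySign_erase_of_lt hw h, boundarySign_erase_of_not_lt h.not_gt]; ring

theorem lcmLabel_insert_le {v : V} {F : Finset V} {u : τ →₀ ℕ} (hv : m v ≤ u)
    (hF : lcmLabel m F ≤ u) : lcmLabel m (insert v F) ≤ u := by
  rw [lcmLabel, Finset.sup_insert]; exact sup_le hv hF

/-- The differential of the Taylor complex, on the free module on all finite subsets. -/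
def taylorDifferential :
    (Finset V →₀ MvPolynomial τ k) →ₗ[MvPolynomial τ k] (Finset V →₀ MvPolynomial τ k) :=
  Finsupp.linearCombination (MvPolynomial τ k) fun F : Finset V =>
    ∑ v ∈ F, Finsupp.single (F.erase v)
      ((-1) ^ (F.filter fun w => w < v).card * mono k (lcmLabel m F - lcmLabel m (F.erase v)))

theorem taylorDifferential_homogeneousFace {u : τ →₀ ℕ} {F : Finset V} (h : lcmLabel m F ≤ u) :
    taylorDifferential k m (homogeneousFace k m u F) =
      ∑ v ∈ F, boundarySign v F • homogeneousFace k m u (F.erase v) := by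
  rw [taylorDifferential, homogeneousFace, Finsupp.linearCombination_single, Finset.smul_sum]
  refine Finset.sum_congr rfl fun v _ => ?_
  have h' := lcmLabel_mono m (Finset.erase_subset v F)
  rw [homogeneousFace, Finsupp.smul_single, Finsupp.smul_single, smul_eq_mul, mul_left_comm,
    mono_mul, tsub_add_tsub_cancel h h', boundarySign, zsmul_eq_mul]
  push_cast
  rfl

theorem taylorDifferential_comp_self_homogeneousFace {u : τ →₀ ℕ} {F : Finset V}
    (h : lcmLabel m F ≤ u) :
    taylorDifferential k m (taylorDifferential k m (homogeneousFace k m u F)) = 0 := by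
  rw [taylorDifferential_homogeneousFace k m h, map_sum]
  have : ∀ v ∈ F, taylorDifferential k m (boundarySign v F • homogeneousFace k m u (F.erase v)) =
      ∑ w ∈ F.erase v, (boundarySign v F * boundarySign w (F.erase v)) •
        homogeneousFace k m u ((F.erase v).erase w) := by
    intro v _
    rw [map_zsmul, taylorDifferential_homogeneousFace k m
      ((lcmLabel_mono m (Finset.erase_subset v F)).trans h), Finset.smul_sum]
    simp only [mul_smul]
  rw [Finset.sum_congr rfl this, Finset.sum_sigma']
  refine Finset.sum_involution (fun p _ => ⟨p.2, p.1⟩) ?_ ?_ ?_ ?_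
  · rintro ⟨v, w⟩ hp
    simp only [Finset.mem_sigma, Finset.mem_erase] at hp
    simp only
    rw [boundarySign_mul_erase hp.1 hp.2.2 (Ne.symm hp.2.1), Finset.erase_right_comm, neg_smul,
      neg_add_cancel]
  · rintro ⟨v, w⟩ hp _ heq
    simp only [Finset.mem_sigma, Finset.mem_erase] at hp
    simp only [Sigma.mk.injEq] at heq
    exact hp.2.1 heq.1
  · rintro ⟨v, w⟩ hp
    simp only [Finset.mem_sigma, Finset.mem_erase] at hp ⊢
    exact ⟨hp.2.2, Ne.symm hp.2.1, hp.1⟩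
  · intros; rfl

theorem taylorDifferential_comp_self (y : Finset V →₀ MvPolynomial τ k) :
    taylorDifferential k m (taylorDifferential k m y) = 0 := by
  induction y using Finsupp.induction_linear with
  | zero => simp
  | add y z hy hz => rw [map_add, map_add, hy, hz, add_zero]
  | single F p =>
    have : Finsupp.single F p = p • Finsupp.single F (1 : MvPolynomial τ k) := by simp
    have h1 : Finsupp.single F (1 : MvPolynomial τ k) = homogeneousFace k m (lcmLabel m F) F := by
      simp [homogeneousFace, mono]
    rw [this, map_smul, map_smul, h1, taylorDifferential_comp_self_homogeneousFace k m le_rfl,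
      smul_zero]

/-- In multidegree `u`, the cone construction with apex `a u`. -/
def coneHomotopy (a : (τ →₀ ℕ) → V) :
    (Finset V →₀ MvPolynomial τ k) →ₗ[k] (Finset V →₀ MvPolynomial τ k) :=
  Finsupp.lsum ℕ fun F => (MvPolynomial.basisMonomials τ k).constr k fun w =>
    if a (w + lcmLabel m F) ∈ F then 0 else
      boundarySign (a (w + lcmLabel m F)) (insert (a (w + lcmLabel m F)) F) •
        homogeneousFace k m (w + lcmLabel m F) (insert (a (w + lcmLabel m F)) F)

variable (a : (τ →₀ ℕ) → V)

theorem coneHomotopy_homogeneousFace {u : τ →₀ ℕ} {F : Finset V} (h : lcmLabel m F ≤ u) :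
    coneHomotopy k m a (homogeneousFace k m u F) =
      if a u ∈ F then 0 else
        boundarySign (a u) (insert (a u) F) • homogeneousFace k m u (insert (a u) F) := by
  have hb : mono k (u - lcmLabel m F) = MvPolynomial.basisMonomials τ k (u - lcmLabel m F) := by
    simp [mono]
  rw [coneHomotopy, homogeneousFace, Finsupp.lsum_single, hb, Module.Basis.constr_basis,
    tsub_add_cancel_of_le h]

theorem coneHomotopy_isHomotopy_homogeneousFace {u : τ →₀ ℕ} {F : Finset V}
    (h : lcmLabel m F ≤ u) (ha : m (a u) ≤ u) :
    taylorDifferential k m (coneHomotopy k m a (homogeneousFace k m u F)) +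
      coneHomotopy k m a (taylorDifferential k m (homogeneousFace k m u F)) =
        homogeneousFace k m u F := by
  have herase (v : V) : lcmLabel m (F.erase v) ≤ u :=
    (lcmLabel_mono m (Finset.erase_subset v F)).trans h
  rw [coneHomotopy_homogeneousFace k m a h, taylorDifferential_homogeneousFace k m h, map_sum]
  have hterm (v : V) : coneHomotopy k m a (boundarySign v F • homogeneousFace k m u (F.erase v)) =
      boundarySign v F • if a u ∈ F.erase v then 0 else
        boundarySign (a u) (insert (a u) (F.erase v)) •
          homogeneousFace k m u (insert (a u) (F.erase v)) := by
    rw [map_zsmul, coneHomotopy_homogeneousFace k m a (herase v)]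
  simp only [hterm]
  by_cases haF : a u ∈ F
  · rw [if_pos haF, map_zero, zero_add, Finset.sum_eq_single_of_mem (a u) haF]
    · rw [if_neg (Finset.notMem_erase _ _), Finset.insert_erase haF, smul_smul,
        boundarySign_mul_self, one_smul]
    · intro v _ hv
      rw [if_pos (Finset.mem_erase.mpr ⟨Ne.symm hv, haF⟩), smul_zero]
  · rw [if_neg haF, map_zsmul,
      taylorDifferential_homogeneousFace k m (lcmLabel_insert_le m ha h),
      Finset.sum_insert haF, Finset.erase_insert haF, smul_add, smul_smul, boundarySign_mul_self,
      one_smul, add_assoc, Finset.smul_sum, ← Finset.sum_add_distrib]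
    conv_rhs => rw [← add_zero (homogeneousFace k m u F)]
    congr 1
    refine Finset.sum_eq_zero fun v hv => ?_
    have hva : v ≠ a u := fun e => haF (e ▸ hv)
    have hsgn := boundarySign_mul_erase (Finset.mem_insert_self (a u) F)
      (Finset.mem_insert_of_mem hv) (Ne.symm hva)
    rw [Finset.erase_insert haF, Finset.erase_insert_of_ne (Ne.symm hva)] at hsgn
    have h1 := boundarySign_mul_self v (insert (a u) F)
    have h2 := boundarySign_mul_self v F
    rw [if_neg fun hm => haF (Finset.mem_of_mem_erase hm),
      Finset.erase_insert_of_ne (Ne.symm hva), smul_smul, smul_smul, ← add_smul]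
    have : boundarySign (a u) (insert (a u) F) * boundarySign v (insert (a u) F) +
        boundarySign v F * boundarySign (a u) (insert (a u) (F.erase v)) = 0 := by
      linear_combination (boundarySign v F * boundarySign v (insert (a u) F)) * hsgn
        - boundarySign (a u) (insert (a u) F) * boundarySign v (insert (a u) F) * h2
        - boundarySign v F * boundarySign (a u) (insert (a u) (F.erase v)) * h1
    rw [this, zero_smul]

end Taylor

/-! ### Subcomplexes -/

section Subcomplex

variable {V : Type} (Δ : PreAbstractSimplicialComplex V)
variable (k : Type*) [Field k] {τ : Type*} (m : V → τ →₀ ℕ)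

/-- The inclusion of the free module on the faces of dimension `j` into the one on all finite
subsets. -/
def faceInclusion (j : ℕ) :
    (FaceOfDim Δ j →₀ MvPolynomial τ k) →ₗ[MvPolynomial τ k] (Finset V →₀ MvPolynomial τ k) :=
  Finsupp.lmapDomain _ _ fun F : FaceOfDim Δ j => F.1

theorem faceInclusion_single {j : ℕ} (F : FaceOfDim Δ j) (p : MvPolynomial τ k) :
    faceInclusion Δ k j (Finsupp.single F p) = Finsupp.single F.1 p := by
  simp [faceInclusion]

theorem faceInclusion_injective (j : ℕ) :
    Function.Injective (faceInclusion Δ k (τ := τ) j) :=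
  Finsupp.mapDomain_injective Subtype.val_injective

variable [LinearOrder V]

theorem coe_aug_single (F : FaceOfDim Δ 0) (p : MvPolynomial τ k) :
    ((homogenizedChainComplex Δ k m).aug (Finsupp.single F p) : MvPolynomial τ k) =
      p * mono k (lcmLabel m F.1) :=
  congrArg Subtype.val (Finsupp.linearCombination_single ..)

theorem faceInclusion_homogenizedBoundary (j : ℕ) (y : FaceOfDim Δ (j + 1) →₀ MvPolynomial τ k) :
    faceInclusion Δ k j (homogenizedBoundary Δ k m j y) =
      taylorDifferential k m (faceInclusion Δ k (j + 1) y) := by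
  induction y using Finsupp.induction_linear with
  | zero => simp
  | add y z hy hz => simp only [map_add, hy, hz]
  | single F p =>
    rw [faceInclusion_single, homogenizedBoundary, taylorDifferential,
      Finsupp.linearCombination_single, Finsupp.linearCombination_single, map_smul, map_sum]
    simp only [faceInclusion_single]
    rw [← Finset.sum_attach F.1]
    rfl

theorem taylorDifferential_faceInclusion_zero (y : FaceOfDim Δ 0 →₀ MvPolynomial τ k) :
    taylorDifferential k m (faceInclusion Δ k 0 y) =
      Finsupp.single ∅ ((homogenizedChainComplex Δ k m).aug y : MvPolynomial τ k) := by
  induction y using Finsupp.induction_linear with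
  | zero => simp
  | add y z hy hz => simp only [map_add, hy, hz, Submodule.coe_add, Finsupp.single_add]
  | single F p =>
    obtain ⟨v, hv⟩ := Finset.card_eq_one.mp F.2.2
    have h1 : (({v} : Finset V).filter fun w => w < v) = ∅ := by simp [Finset.filter_singleton]
    have h2 : ({v} : Finset V).erase v = ∅ := by simp
    have h3 : lcmLabel m (∅ : Finset V) = 0 := rfl
    rw [coe_aug_single, faceInclusion_single, taylorDifferential,
      Finsupp.linearCombination_single, hv, Finset.sum_singleton, h1, h2, h3,
      tsub_zero, Finset.card_empty, pow_zero, one_mul, Finsupp.smul_single, smul_eq_mul]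

variable (a : (τ →₀ ℕ) → V)

theorem coneHomotopy_isHomotopy {m} (ha : ∀ u v, m v ≤ u → m (a u) ≤ u) (j : ℕ)
    (y : FaceOfDim Δ j →₀ MvPolynomial τ k) :
    taylorDifferential k m (coneHomotopy k m a (faceInclusion Δ k j y)) +
      coneHomotopy k m a (taylorDifferential k m (faceInclusion Δ k j y)) =
        faceInclusion Δ k j y := by
  induction y using Finsupp.induction_linear with
  | zero => simp
  | add y z hy hz =>
    conv_rhs => rw [map_add, ← hy, ← hz]
    simp only [map_add]
    abel
  | single F p =>
    rw [faceInclusion_single]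
    induction p using MvPolynomial.induction_on' with
    | monomial w c =>
      obtain ⟨v, hv⟩ := (Δ.isRelLowerSet_faces F.2.1).1
      have hle : lcmLabel m F.1 ≤ w + lcmLabel m F.1 := le_add_self
      rw [single_monomial_eq_smul_homogeneousFace k m, map_smul, LinearMap.map_smul_of_tower,
        LinearMap.map_smul_of_tower, map_smul, ← smul_add,
        coneHomotopy_isHomotopy_homogeneousFace k m a hle
          (ha _ v ((le_lcmLabel m hv).trans hle))]
    | add p q hp hq =>
      conv_rhs => rw [Finsupp.single_add, ← hp, ← hq]
      simp only [map_add, Finsupp.single_add]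
      abel

theorem coneHomotopy_mem_range {m}
    (ha : ∀ u, ∀ F ∈ Δ.faces, lcmLabel m F ≤ u → insert (a u) F ∈ Δ.faces) (j : ℕ)
    (y : FaceOfDim Δ j →₀ MvPolynomial τ k) :
    ∃ z, faceInclusion Δ k (j + 1) z = coneHomotopy k m a (faceInclusion Δ k j y) := by
  induction y using Finsupp.induction_linear with
  | zero => exact ⟨0, by simp⟩
  | add y z hy hz =>
    obtain ⟨y', hy⟩ := hy
    obtain ⟨z', hz⟩ := hz
    exact ⟨y' + z', by simp only [map_add, hy, hz]⟩
  | single F p =>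
    rw [faceInclusion_single]
    induction p using MvPolynomial.induction_on' with
    | monomial w c =>
      have hle : lcmLabel m F.1 ≤ w + lcmLabel m F.1 := le_add_self
      rw [single_monomial_eq_smul_homogeneousFace k m, map_smul,
        coneHomotopy_homogeneousFace k m a hle]
      split_ifs with hF
      · exact ⟨0, by simp⟩
      · obtain ⟨G, hG⟩ : ∃ G : FaceOfDim Δ (j + 1), G.1 = insert (a (w + lcmLabel m F.1)) F.1 :=
          ⟨⟨_, ha _ _ F.2.1 hle, (Finset.card_insert_of_notMem hF).trans
            (congrArg (· + 1) F.2.2)⟩, rfl⟩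
        rw [← hG]
        refine ⟨c • boundarySign (a (w + lcmLabel m F.1)) G.1 •
          Finsupp.single G (mono k (w + lcmLabel m F.1 - lcmLabel m G.1)), ?_⟩
        rw [LinearMap.map_smul_of_tower, map_zsmul, faceInclusion_single, homogeneousFace]
    | add p q hp hq =>
      obtain ⟨y', hy⟩ := hp
      obtain ⟨z', hz⟩ := hq
      exact ⟨y' + z', by simp only [map_add, hy, hz, Finsupp.single_add]⟩

theorem supportsFreeResolution_of_apex [Finite V] {m} (hΔ : ∀ v, {v} ∈ Δ.faces)
    (ha : ∀ u v, m v ≤ u → m (a u) ≤ u)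
    (ha' : ∀ u, ∀ F ∈ Δ.faces, lcmLabel m F ≤ u → insert (a u) F ∈ Δ.faces) :
    SupportsFreeResolution Δ k m := by
  have key (j : ℕ) (y : FaceOfDim Δ j →₀ MvPolynomial τ k)
      (hy : taylorDifferential k m (faceInclusion Δ k j y) = 0) :
      ∃ z, homogenizedBoundary Δ k m j z = y := by
    obtain ⟨z, hz⟩ := coneHomotopy_mem_range Δ k a ha' j y
    refine ⟨z, faceInclusion_injective Δ k j ?_⟩
    have := coneHomotopy_isHomotopy Δ k a ha j y
    rwa [hy, map_zero, add_zero, ← hz, ← faceInclusion_homogenizedBoundary] at this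
  have hinj : Function.Injective (Finsupp.single (∅ : Finset V) : MvPolynomial τ k → _) :=
    Finsupp.single_injective _
  refine ⟨fun j => ?_, ⟨Nat.card V, fun j hj => ⟨fun F => ?_⟩⟩, ?_, ?_, fun j => ?_⟩
  · exact Subtype.finite
  · have := Fintype.ofFinite V
    have h1 := Finset.card_le_univ F.1
    have h2 := F.2.2
    rw [Nat.card_eq_fintype_card] at hj
    omega
  · rw [← LinearMap.range_eq_top, eq_top_iff,
      ← Submodule.map_le_map_iff_of_injective (Submodule.injective_subtype _),
      Submodule.map_top, Submodule.range_subtype]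
    refine Ideal.span_le.mpr ?_
    rintro _ ⟨v, rfl⟩
    refine ⟨_, ⟨Finsupp.single (⟨{v}, hΔ v, Finset.card_singleton v⟩ : FaceOfDim Δ 0) 1, rfl⟩,
      (coe_aug_single Δ k m _ _).trans ?_⟩
    simp [lcmLabel]
  · intro y
    constructor
    · intro hy
      exact key 0 y (by rw [taylorDifferential_faceInclusion_zero, hy]; simp)
    · rintro ⟨z, rfl⟩
      refine Subtype.ext (hinj ?_)
      rw [← taylorDifferential_faceInclusion_zero, faceInclusion_homogenizedBoundary,
        taylorDifferential_comp_self]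
      simp
  · intro y
    constructor
    · intro hy
      exact key (j + 1) y (by rw [← faceInclusion_homogenizedBoundary, hy, map_zero])
    · rintro ⟨z, rfl⟩
      refine faceInclusion_injective Δ k j ?_
      rw [faceInclusion_homogenizedBoundary, faceInclusion_homogenizedBoundary,
        taylorDifferential_comp_self, map_zero]

end Subcomplex

/-! ### Comparison of free resolutions -/

namespace FreeSequence

variable {R : Type*} [CommRing R] {M : Type*} [AddCommGroup M] [Module R M]

theorem exists_lift_of_range_le {ι N P : Type*} [AddCommGroup N] [Module R N] [AddCommGroup P]
    [Module R P] (d : N →ₗ[R] P) (f : (ι →₀ R) →ₗ[R] P) (h : ∀ x, f x ∈ Set.range d) :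
    ∃ g : (ι →₀ R) →ₗ[R] N, d ∘ₗ g = f := by
  choose n hn using fun i => h (Finsupp.single i 1)
  refine ⟨Finsupp.linearCombination R n, ?_⟩
  ext i
  simp [hn]

/-- Free resolutions of the same module are related by a chain map over the identity. -/
theorem IsFreeResolution.exists_chainMap {C C' : FreeSequence R M} (hC : C.IsFreeResolution)
    (hC' : C'.IsFreeResolution) :
    ∃ f : ∀ j, (C.ι j →₀ R) →ₗ[R] (C'.ι j →₀ R),
      C'.aug ∘ₗ f 0 = C.aug ∧ ∀ j, C'.d j ∘ₗ f (j + 1) = f j ∘ₗ C.d j := by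
  obtain ⟨f₀, h₀⟩ := exists_lift_of_range_le C'.aug C.aug fun x => hC'.aug_surjective _
  have hstep (j : ℕ) (f : (C.ι j →₀ R) →ₗ[R] (C'.ι j →₀ R))
      (hf : ∀ x, f (C.d j x) ∈ Set.range (C'.d j)) :
      ∃ g : (C.ι (j + 1) →₀ R) →ₗ[R] (C'.ι (j + 1) →₀ R), C'.d j ∘ₗ g = f ∘ₗ C.d j ∧
        ∀ x, g (C.d (j + 1) x) ∈ Set.range (C'.d (j + 1)) := by
    obtain ⟨g, hg⟩ := exists_lift_of_range_le (C'.d j) (f ∘ₗ C.d j) hf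
    refine ⟨g, hg, fun x => (hC'.exact_succ j _).mp ?_⟩
    have := LinearMap.congr_fun hg (C.d (j + 1) x)
    simpa [(hC.exact_succ j _).mpr ⟨x, rfl⟩] using this
  choose g hg hg' using hstep
  have hf₀ (x) : f₀ (C.d 0 x) ∈ Set.range (C'.d 0) := by
    refine (hC'.exact_zero _).mp ?_
    have := LinearMap.congr_fun h₀ (C.d 0 x)
    simpa [(hC.exact_zero _).mpr ⟨x, rfl⟩] using this
  let F : ∀ j, {f : (C.ι j →₀ R) →ₗ[R] (C'.ι j →₀ R) //
      ∀ x, f (C.d j x) ∈ Set.range (C'.d j)} := fun j =>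
    Nat.rec ⟨f₀, hf₀⟩ (fun j f => ⟨g j f.1 f.2, hg' j f.1 f.2⟩) j
  exact ⟨fun j => (F j).1, h₀, fun j => hg j (F j).1 (F j).2⟩

/-- If all the entries of the differentials of a free resolution are killed by a ring
homomorphism `ε`, every chain endomorphism over the identity is the identity modulo `ε`. -/
theorem IsFreeResolution.chainMap_sub_id_mem {C : FreeSequence R M} (hC : C.IsFreeResolution)
    {K : Type*} [Semiring K] (ε : R →+* K) (hε : ∀ j x i, ε (C.d j x i) = 0)
    (φ : ∀ j, (C.ι j →₀ R) →ₗ[R] (C.ι j →₀ R)) (h₀ : C.aug ∘ₗ φ 0 = C.aug)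
    (hφ : ∀ j, C.d j ∘ₗ φ (j + 1) = φ j ∘ₗ C.d j) (j : ℕ) (x : C.ι j →₀ R) (i : C.ι j) :
    ε ((φ j x - x) i) = 0 := by
  have hlin {ι κ : Type} (h : (ι →₀ R) →ₗ[R] (κ →₀ R)) (y : ι →₀ R) (hy : ∀ i, ε (y i) = 0)
      (i : κ) : ε (h y i) = 0 := by
    have : y = Finsupp.linearCombination R (fun i => Finsupp.single i (1 : R)) y := by
      simp [Finsupp.linearCombination_apply]
    rw [this, Finsupp.linearCombination_apply, Finsupp.sum, map_sum, Finsupp.finsetSum_apply,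
      map_sum]
    refine Finset.sum_eq_zero fun l _ => ?_
    rw [map_smul, Finsupp.smul_apply, smul_eq_mul, map_mul, hy, zero_mul]
  have claim : ∃ χ : (C.ι j →₀ R) →ₗ[R] (C.ι j →₀ R), (∀ x i, ε (χ x i) = 0) ∧
      χ ∘ₗ C.d j = 0 ∧ ∀ x, (φ j - LinearMap.id - χ : (C.ι j →₀ R) →ₗ[R] (C.ι j →₀ R)) x ∈
        Set.range (C.d j) := by
    clear x i
    induction j with
    | zero =>
      refine ⟨0, by simp, by simp, fun x => (hC.exact_zero _).mp ?_⟩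
      have := LinearMap.congr_fun h₀ x
      simpa [sub_eq_zero] using this
    | succ j ih =>
      obtain ⟨χ, -, hχd, hχ⟩ := ih
      obtain ⟨h, hh⟩ := exists_lift_of_range_le (C.d j) _ hχ
      refine ⟨h ∘ₗ C.d j, fun x i => hlin h _ (hε j x) i, ?_, fun x =>
        (hC.exact_succ j _).mp ?_⟩
      · ext1 y
        ext1
        simp [(hC.exact_succ j _).mpr ⟨_, rfl⟩]
      · have e1 := LinearMap.congr_fun hh (C.d j x)
        have e2 := LinearMap.congr_fun (hφ j) x
        have e3 := LinearMap.congr_fun hχd x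
        simp only [LinearMap.comp_apply, LinearMap.sub_apply, LinearMap.id_apply,
          LinearMap.zero_apply, map_sub] at e1 e2 e3 ⊢
        rw [e1, e2, e3]
        abel
  obtain ⟨χ, h1, -, h2⟩ := claim
  obtain ⟨z, hz⟩ := h2 x
  have : φ j x - x = C.d j z + χ x := by rw [hz]; simp
  rw [this, Finsupp.add_apply, map_add, hε, h1, add_zero]

/-- A linear map of finite free modules with a left inverse modulo `ε` does not decrease
the rank. -/
theorem card_le_card_of_leftInverse_mod {K : Type*} [Field K] (ε : R →+* K) {ι κ : Type}
    [Finite ι] [Finite κ] (f : (ι →₀ R) →ₗ[R] (κ →₀ R)) (g : (κ →₀ R) →ₗ[R] (ι →₀ R))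
    (h : ∀ x i, ε ((g (f x) - x) i) = 0) : Nat.card ι ≤ Nat.card κ := by
  classical
  have := Fintype.ofFinite ι
  have := Fintype.ofFinite κ
  let A : Matrix κ ι K := .of fun c i => ε (f (Finsupp.single i 1) c)
  let B : Matrix ι κ K := .of fun i c => ε (g (Finsupp.single c 1) i)
  have hBA : B * A = 1 := by
    ext i i'
    have h1 := h (Finsupp.single i' 1) i
    rw [Finsupp.sub_apply, map_sub, sub_eq_zero] at h1
    have h2 : f (Finsupp.single i' 1) =
        ∑ c, f (Finsupp.single i' 1) c • Finsupp.single c (1 : R) := by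
      conv_lhs => rw [← Finsupp.univ_sum_single (f (Finsupp.single i' 1))]
      simp
    rw [h2, map_sum, Finsupp.finsetSum_apply, map_sum] at h1
    rw [Matrix.mul_apply, Matrix.one_apply]
    simp only [map_smul, Finsupp.smul_apply, smul_eq_mul, map_mul] at h1
    simp only [A, B, Matrix.of_apply, mul_comm (ε (g _ _))]
    rw [h1, Finsupp.single_apply]
    simp only [eq_comm (a := i)]
    split_ifs <;> simp
  rw [Nat.card_eq_fintype_card, Nat.card_eq_fintype_card, ← Matrix.rank_one (R := K) (n := ι), ← hBA]
  exact (Matrix.rank_mul_le_right B A).trans (Matrix.rank_le_card_height A)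

/-- A free resolution all of whose entries are killed by a ring homomorphism to a field is
minimal. -/
theorem IsFreeResolution.isMinimal {C : FreeSequence R M} (hC : C.IsFreeResolution)
    {K : Type*} [Field K] (ε : R →+* K) (hε : ∀ j x i, ε (C.d j x i) = 0) :
    C.IsMinimalFreeResolution := by
  refine ⟨hC, fun C' hC' j => ?_⟩
  obtain ⟨f, hf₀, hf⟩ := hC.exists_chainMap hC'
  obtain ⟨g, hg₀, hg⟩ := hC'.exists_chainMap hC
  have := hC.finite_rank j
  have := hC'.finite_rank j
  refine card_le_card_of_leftInverse_mod ε (f j) (g j) ?_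
  refine hC.chainMap_sub_id_mem ε hε (fun j => g j ∘ₗ f j) ?_ (fun j => ?_) j
  · rw [← LinearMap.comp_assoc, hg₀, hf₀]
  · rw [← LinearMap.comp_assoc, hg, LinearMap.comp_assoc, hf, LinearMap.comp_assoc]

end FreeSequence

/-! ### The complex of faces not containing a given face -/

section FacesNotContaining

variable (k : Type*) [Field k]

theorem supportsFreeResolution_facesNotContaining {V : Type} [LinearOrder V] [Finite V]
    {τ : Type*} (m : V → τ →₀ ℕ) {σ : Finset V} (hσ : 1 < σ.card) {b : V} (hb : b ∉ σ)
    (hm : m b ≤ lcmLabel m σ) :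
    SupportsFreeResolution (facesNotContaining σ) k m := by
  classical
  have hne : ∀ u : τ →₀ ℕ, ∃ v : V,
      (∀ w, m w ≤ u → m v ≤ u) ∧ (lcmLabel m σ ≤ u → v = b) := by
    intro u
    by_cases hu : lcmLabel m σ ≤ u
    · exact ⟨b, fun _ _ => hm.trans hu, fun _ => rfl⟩
    · by_cases hw : ∃ w, m w ≤ u
      · exact ⟨hw.choose, fun _ _ => hw.choose_spec, fun h => absurd h hu⟩
      · exact ⟨b, fun w h => absurd ⟨w, h⟩ hw, fun _ => rfl⟩
  choose a ha hab using hne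
  refine supportsFreeResolution_of_apex _ k a (fun v => ⟨Finset.singleton_nonempty v, ?_⟩) ha ?_
  · intro h
    have := Finset.card_le_card h
    rw [Finset.card_singleton] at this
    omega
  · rintro u F hF hFu
    refine ⟨Finset.insert_nonempty _ _, fun hsub => ?_⟩
    by_cases hσu : lcmLabel m σ ≤ u
    · rw [hab u hσu] at hsub
      exact hF.2 ((Finset.subset_insert_iff_of_notMem hb).mp hsub)
    · obtain ⟨v, hv⟩ := hF.1
      have hau := ha u v ((le_lcmLabel m hv).trans hFu)
      exact hσu ((lcmLabel_mono m hsub).trans (lcmLabel_insert_le m hau hFu))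

/-- If no label divides the least common multiple of the other labels of a face of `Δ`, the
entries of the boundary maps have no constant term. -/
theorem constantCoeff_homogenizedBoundary {V : Type} [LinearOrder V]
    (Δ : PreAbstractSimplicialComplex V) {τ : Type*} {m : V → τ →₀ ℕ}
    (h : ∀ F ∈ Δ.faces, ∀ v ∈ F, ¬ m v ≤ lcmLabel m (F.erase v)) (j : ℕ)
    (y : FaceOfDim Δ (j + 1) →₀ MvPolynomial τ k) (G : FaceOfDim Δ j) :
    MvPolynomial.constantCoeff (homogenizedBoundary Δ k m j y G) = 0 := by
  classical
  induction y using Finsupp.induction_linear with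
  | zero => simp
  | add y z hy hz => rw [map_add, Finsupp.add_apply, map_add, hy, hz, add_zero]
  | single F p =>
    rw [homogenizedBoundary, Finsupp.linearCombination_single, Finsupp.smul_apply, smul_eq_mul,
      map_mul, Finsupp.finsetSum_apply, map_sum, Finset.sum_eq_zero, mul_zero]
    rintro ⟨v, hv⟩ _
    have hne : lcmLabel m F.1 - lcmLabel m (F.1.erase v) ≠ 0 := fun h0 =>
      h F.1 F.2.1 v hv ((le_lcmLabel m hv).trans (tsub_eq_zero_iff_le.mp h0))
    rw [Finsupp.single_apply]
    split_ifs
    · rw [map_mul, mono, MvPolynomial.constantCoeff_monomial, if_neg hne, mul_zero]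
    · exact map_zero _

end FacesNotContaining

/-! ### Extremal ideals -/

section Extremal

variable {q : ℕ} (D : Set (Fin q × Finset (Fin q)))

open Classical in
theorem extremalGen_apply (i : Fin q) (A : ExtremalVar q) :
    extremalGen D i A = if A ∈ extremalQ D ∧ i ∈ A.1 then 1 else 0 := by
  simp [extremalGen, Finsupp.finsetSum_apply, Finsupp.single_apply, Finset.sum_ite_eq']

theorem lcmLabel_apply {V τ : Type*} (m : V → τ →₀ ℕ) (F : Finset V) (x : τ) :
    lcmLabel m F x = F.sup fun v => m v x := by
  classical
  induction F using Finset.induction_on with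
  | empty => rfl
  | insert v F _ ih => simpa [lcmLabel, Finset.sup_insert] using ih ▸ rfl

theorem extremalGen_le_lcmLabel {b : Fin q} {B : Finset (Fin q)} (h : (b, B) ∈ D) :
    extremalGen D b ≤ lcmLabel (extremalGen D) B := by
  classical
  intro A
  rw [extremalGen_apply]
  split_ifs with hA
  · obtain ⟨v, hv⟩ := (hA.1 _ h).resolve_left (not_not.mpr hA.2)
    rw [Finset.mem_inter] at hv
    have := le_lcmLabel (extremalGen D) hv.2 A
    rwa [extremalGen_apply, if_pos ⟨hA.1, hv.1⟩] at this
  · exact Nat.zero_le _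

theorem not_extremalGen_le_lcmLabel_erase {σ : Finset (Fin q)} (hD : ∀ p ∈ D, p.2 = σ)
    {F : Finset (Fin q)} (hF : ¬ σ ⊆ F) {v : Fin q} :
    ¬ extremalGen D v ≤ lcmLabel (extremalGen D) (F.erase v) := by
  classical
  intro h
  let A : ExtremalVar q := ⟨(F.erase v)ᶜ, ⟨v, by simp⟩⟩
  have hA : A ∈ extremalQ D := by
    intro p hp
    right
    rw [hD p hp]
    obtain ⟨x, hx, hxF⟩ := Finset.not_subset.mp hF
    exact ⟨x, by simp [A, hx, hxF]⟩
  have hle := h A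
  rw [extremalGen_apply, if_pos ⟨hA, by simp [A]⟩, lcmLabel_apply] at hle
  obtain ⟨w, hw, hle⟩ := (Finset.le_sup_iff Nat.zero_lt_one).mp hle
  rw [extremalGen_apply, if_neg] at hle
  · omega
  · rintro ⟨-, hwA⟩
    exact Finset.mem_compl.mp hwA hw

end Extremal

theorem one_lt_card_twoToS {q s : ℕ} (hs : 3 ≤ s) (hsq : s ≤ q) : 1 < (twoToS q s).card := by
  refine Finset.one_lt_card.mpr ⟨⟨1, by omega⟩, ?_, ⟨2, by omega⟩, ?_, by simp⟩ <;>
    simp [twoToS] <;> omega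

end

theorem theorem5p1 {k : Type*} [Field k] (q s : ℕ) (hs : 3 ≤ s) (hsq : s ≤ q) :
    -- every ideal minimally generated by square-free monomials with the given relation
    (∀ {τ : Type*} [Finite τ] (m : Fin q → τ →₀ ℕ),
      (∀ i x, m i x ≤ 1) →
      MinimallyGenerates k m →
      mono k (m ⟨0, by omega⟩) ∣ mono k (lcmLabel m (twoToS q s)) →
      SupportsFreeResolution (facesNotContaining (twoToS q s)) k m) ∧
    -- the extremal ideals
    (∀ J : Set (Fin q), (∀ b ∈ J, s ≤ b.val) →
      SupportsMinimalFreeResolution (facesNotContaining (twoToS q s)) k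
        (extremalGen ({(⟨0, by omega⟩, twoToS q s)} ∪ {p | p.1 ∈ J ∧ p.2 = twoToS q s}))) := by
  have hcard := one_lt_card_twoToS hs hsq
  have h0 : (⟨0, by omega⟩ : Fin q) ∉ twoToS q s := by simp [twoToS]
  refine ⟨fun m _ _ hdvd => ?_, fun J _ => ?_⟩
  · refine supportsFreeResolution_facesNotContaining k m hcard h0 ?_
    rw [mono, mono, MvPolynomial.monomial_dvd_monomial] at hdvd
    exact hdvd.1.resolve_left one_ne_zero
  · set D : Set (Fin q × Finset (Fin q)) :=
      {(⟨0, by omega⟩, twoToS q s)} ∪ {p | p.1 ∈ J ∧ p.2 = twoToS q s}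
    have hres : SupportsFreeResolution (facesNotContaining (twoToS q s)) k (extremalGen D) :=
      supportsFreeResolution_facesNotContaining k _ hcard h0
        (extremalGen_le_lcmLabel D (Or.inl rfl))
    refine FreeSequence.IsFreeResolution.isMinimal hres MvPolynomial.constantCoeff ?_
    refine constantCoeff_homogenizedBoundary k _ fun F hF v _ => ?_
    refine not_extremalGen_le_lcmLabel_erase D ?_ hF.2
    rintro p (rfl | hp)
    · rfl
    · exact hp.2
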